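/- \textbf{Definitions.} Let $G$ be a group with a finite presentation $\langle X\mid R\rangle$. The \emph{area} of a word $w$ in $X^{\pm1}$ with $w=1$ in $G$ is the least $k$ such that $w$ is freely equal to a product of $k$ conjugates of elements of $R^{\pm1}$. The \emph{Dehn function} of the presentation is the function $\delta:\mathbb N\to\mathbb N$ for which $\delta(n)$ is the maximal area of a word of length at most $n$ that represents $1$ in $G$. A \emph{(non-deterministic, multi-tape) Turing machine} has a finite tape alphabet $Y$, finite sets $Q_1,\dots,Q_N$ ($N\ge 1$) of state letters (which include the endmarkers separating the tapes), and a finite set of commands $[U_1\to V_1,\dots,U_N\to V_N]$, where each $U_i$ has the form $v_iq_iu_i$, each $V_i$ has the form $v_i'q_i'u_i'$, the letters $q_i,q_i'$ lie in $Q_i$, and $u_i,v_i,u_i',v_i'$ are words in $Y$. A configuration is a word $w_0q_1w_1q_2\cdots q_Nw_N$ with $q_i\in Q_i$ and $w_j$ words in $Y$. A command is applied by simultaneously replacing disjoint subwords $U_1,\dots,U_N$ of a configuration by $V_1,\dots,V_N$. The input alphabet is a subset of $Y$; in the input configuration of a word $w$ in the input alphabet, the state letters are fixed start letters, $w$ stands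 in one fixed place among $w_0,\dots,w_N$, and the other places are empty. One configuration is chosen as the accept configuration, and $w$ is \emph{accepted} if some finite sequence of commands (possibly empty) leads from the input configuration of $w$ to it. The \emph{time function} $T:\mathbb N\to\mathbb N$ of the machine assigns to $n$ the least $t$ such that every accepted input of length at most $n$ is accepted by some computation with at most $t$ steps. The machine \emph{solves} (non-deterministically) the word problem of $\langle X\mid R\rangle$ if its input alphabet is $X\cup X^{-1}$ and it accepts a word $w$ if and only if $w=1$ in $G$. Non-decreasing functions $f,g:\mathbb N\to\mathbb N$ are \emph{equivalent} if there is an integer $C\ge1$ such that for all $n\in\mathbb N$ $$\frac1C\,g\!\left(\left\lfloor \frac nC\right\rfloor\right)-Cn\;\le\; f(n)\;\le\; C\,g(Cn)+Cn .$$ \textbf{Theorem.} For every finite presentation $\langle X\mid R\rangle$ of a group $G$ there is a non-deterministic Turing machine that solves the word problem of $\langle X\mid R\rangle$ and whose time function is equivalent to the Dehn function of $\langle X\mid R\rangle$. -/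

import Mathlib

universe u v

/-- A finite presentation `⟨X | R⟩` of the group `G`: an interpretation of the letters of the finite
set `X` as generators of `G`, and a finite set `R` of relators whose normal closure in the free
group on `X` is the kernel of the induced map onto `G`. -/
structure FinitePresentation (G : Type u) [Group G] (X : Type v) where
  gen : X → G
  rels : Set (FreeGroup X)
  finite_gens : Finite X
  finite_rels : rels.Finite
  surjective : Function.Surjective (FreeGroup.lift gen)
  ker_eq : (FreeGroup.lift gen).ker = Subgroup.normalClosure rels

namespace FinitePresentation

variable {G : Type u} [Group G] {X : Type v} (P : FinitePresentation G X)

/-- The element of `G` represented by a (not necessarily reduced) word in the letters `x` and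
`x⁻¹`, written `(x, true)` and `(x, false)`. -/
def eval (w : List (X × Bool)) : G := FreeGroup.lift P.gen (FreeGroup.mk w)

/-- `w` is freely equal to a product of `k` conjugates of relators and inverses of relators. -/
def IsProductOfConjugates (w : List (X × Bool)) (k : ℕ) : Prop :=
  ∃ l : List (FreeGroup X), l.length = k ∧ l.prod = FreeGroup.mk w ∧
    ∀ y ∈ l, ∃ r ∈ P.rels, ∃ h : FreeGroup X, y = h * r * h⁻¹ ∨ y = h * r⁻¹ * h⁻¹

/-- The area of a word representing `1`. -/
noncomputable def area (w : List (X × Bool)) : ℕ := sInf {k | P.IsProductOfConjugates w k}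

/-- The Dehn function: the least bound for the area of the words of length at most `n` that
represent `1`. -/
noncomputable def dehnFunction (n : ℕ) : ℕ :=
  sInf {t | ∀ w : List (X × Bool), w.length ≤ n → P.eval w = 1 → P.area w ≤ t}

/-- The minimum that defines the area of a word representing `1` is attained. -/
theorem area_isLeast {w : List (X × Bool)} (hw : P.eval w = 1) :
    IsLeast {k | P.IsProductOfConjugates w k} (P.area w) := by
  have hne : {k | P.IsProductOfConjugates w k}.Nonempty := by
    have h : FreeGroup.mk w ∈ (FreeGroup.lift P.gen).ker := hw
    rw [P.ker_eq, Subgroup.normalClosure, ← Subgroup.mem_toSubmonoid,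
      Subgroup.closure_toSubmonoid] at h
    obtain ⟨l, hl, hp⟩ := Submonoid.exists_list_of_mem_closure h
    refine ⟨l.length, l, rfl, hp, fun y hy => ?_⟩
    rcases hl y hy with h1 | h1
    · obtain ⟨r, hr, hc⟩ := Group.mem_conjugatesOfSet_iff.1 h1
      obtain ⟨c, hc⟩ := isConj_iff.1 hc
      exact ⟨r, hr, c, Or.inl hc.symm⟩
    · obtain ⟨r, hr, hc⟩ := Group.mem_conjugatesOfSet_iff.1 (Set.mem_inv.1 h1)
      obtain ⟨c, hc⟩ := isConj_iff.1 hc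
      refine ⟨r, hr, c, Or.inr ?_⟩
      rw [← inv_inv y, ← hc]
      group
  exact ⟨Nat.sInf_mem hne, fun k hk => Nat.sInf_le hk⟩

/-- The minimum that defines the Dehn function is attained. -/
theorem dehnFunction_isLeast (n : ℕ) :
    IsLeast {t | ∀ w : List (X × Bool), w.length ≤ n → P.eval w = 1 → P.area w ≤ t}
      (P.dehnFunction n) := by
  have := P.finite_gens
  have hne : {t | ∀ w : List (X × Bool), w.length ≤ n → P.eval w = 1 → P.area w ≤ t}.Nonempty := by
    obtain ⟨b, hb⟩ := ((List.finite_length_le (X × Bool) n).image P.area).bddAbove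
    exact ⟨b, fun w hw _ => hb ⟨w, hw, rfl⟩⟩
  exact ⟨Nat.sInf_mem hne, fun k hk => Nat.sInf_le hk⟩

end FinitePresentation

/-- A transition `v q u → v' q' u'` of one head, where `q`, `q'` are state letters and `v`, `u`,
`v'`, `u'` are words in the tape alphabet. -/
structure HeadCommand (Y : Type u) (Q : Type) where
  left : List Y
  state : Q
  right : List Y
  newLeft : List Y
  newState : Q
  newRight : List Y

/-- A configuration `u₀ q₁ u₁ q₂ ⋯ q_N u_N`, with one state letter from each of the `N` sets of
state letters. -/
structure TMConfig (N : ℕ) (Y : Type u) (Q : Fin N → Type) where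
  tape : Fin (N + 1) → List Y
  state : (i : Fin N) → Q i

/-- A (non-deterministic, multi-tape) Turing machine with input alphabet `A`. State letters from
the sets `Q i` include the endmarkers that separate tapes. -/
structure TuringMachine (A : Type u) where
  N : ℕ
  N_pos : 0 < N
  Y : Type u
  finite_Y : Finite Y
  Q : Fin N → Type
  finite_Q : ∀ i, Finite (Q i)
  commands : Set ((i : Fin N) → HeadCommand Y (Q i))
  finite_commands : commands.Finite
  inputLetter : A ↪ Y
  inputTape : Fin (N + 1)
  startState : (i : Fin N) → Q i
  acceptConfig : TMConfig N Y Q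

namespace TuringMachine

variable {A : Type u} (M : TuringMachine A)

/-- One step `c → d`: for some command `[U₁ → V₁, …, U_N → V_N]`, disjoint subwords `U₁, …, U_N`
of `c` are replaced simultaneously by `V₁, …, V_N`. The words `x j` are what is left untouched
between them. -/
def Step (c d : TMConfig M.N M.Y M.Q) : Prop :=
  ∃ θ ∈ M.commands, ∃ x : Fin (M.N + 1) → List M.Y,
    (∀ i, c.state i = (θ i).state) ∧
    (∀ i, d.state i = (θ i).newState) ∧
    (∀ j, c.tape j =
      (Fin.cons [] (fun i => (θ i).right) : Fin (M.N + 1) → List M.Y) j ++ x j ++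
      (Fin.snoc (fun i => (θ i).left) [] : Fin (M.N + 1) → List M.Y) j) ∧
    (∀ j, d.tape j =
      (Fin.cons [] (fun i => (θ i).newRight) : Fin (M.N + 1) → List M.Y) j ++ x j ++
      (Fin.snoc (fun i => (θ i).newLeft) [] : Fin (M.N + 1) → List M.Y) j)

/-- There is a computation with exactly `t` steps from `c` to `d`. -/
def ReachesIn : ℕ → TMConfig M.N M.Y M.Q → TMConfig M.N M.Y M.Q → Prop
  | 0, c, d => c = d
  | t + 1, c, d => ∃ e, M.Step c e ∧ ReachesIn t e d

/-- The input configuration: start states, with `w` on the input tape and nothing elsewhere. -/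
def inputConfig (w : List A) : TMConfig M.N M.Y M.Q where
  tape j := if j = M.inputTape then w.map M.inputLetter else []
  state := M.startState

/-- Some computation takes the input `w` to the accept configuration in exactly `t` steps. -/
def AcceptsIn (w : List A) (t : ℕ) : Prop := M.ReachesIn t (M.inputConfig w) M.acceptConfig

/-- The input `w` is accepted. -/
def Accepts (w : List A) : Prop := ∃ t, M.AcceptsIn w t

/-- The time function: the least `t` such that every accepted input of length at most `n` is
accepted by some computation with at most `t` steps. -/
noncomputable def timeFunction (n : ℕ) : ℕ :=
  sInf {t | ∀ w : List A, w.length ≤ n → M.Accepts w → ∃ s ≤ t, M.AcceptsIn w s}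

/-- The minimum that defines the time function is attained. -/
theorem timeFunction_isLeast (n : ℕ) :
    IsLeast {t | ∀ w : List A, w.length ≤ n → M.Accepts w → ∃ s ≤ t, M.AcceptsIn w s}
      (M.timeFunction n) := by
  have := M.finite_Y
  have : Finite A := Finite.of_injective _ M.inputLetter.injective
  have hne : {t | ∀ w : List A, w.length ≤ n → M.Accepts w →
      ∃ s ≤ t, M.AcceptsIn w s}.Nonempty := by
    classical
    obtain ⟨b, hb⟩ := ((List.finite_length_le A n).image
      (fun w => if h : M.Accepts w then h.choose else 0)).bddAbove
    refine ⟨b, fun w hw ha => ⟨ha.choose, ?_, ha.choose_spec⟩⟩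
    have := hb ⟨w, hw, rfl⟩
    simpa [ha] using this
  exact ⟨Nat.sInf_mem hne, fun k hk => Nat.sInf_le hk⟩

/-- `M` solves (non-deterministically) the word problem of the group with presentation `P`. -/
def SolvesWordProblem {G : Type v} [Group G] {X : Type u} (P : FinitePresentation G X)
    (M : TuringMachine (X × Bool)) : Prop :=
  ∀ w : List (X × Bool), M.Accepts w ↔ P.eval w = 1

end TuringMachine

/-- Equivalence of increasing functions:
`g(n / C) / C - C n ≤ f(n) ≤ C g(C n) + C n` for some constant `C ≥ 1`, where `n / C` as an
argument of `g` is rounded down. -/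
def GrowthEquivalent (f g : ℕ → ℕ) : Prop :=
  ∃ C : ℕ, 0 < C ∧ ∀ n : ℕ,
    (1 / C : ℝ) * (g (n / C) : ℝ) - (C : ℝ) * n ≤ (f n : ℝ) ∧
    (f n : ℝ) ≤ (C : ℝ) * (g (C * n) : ℝ) + (C : ℝ) * n

/-! The machine has one head. It moves right over a letter, cancels an inverse pair at the head, or
inserts a symmetrized relator, and it accepts on the empty tape. Only insertions change the element
of the free group, each by a conjugate of a relator or its inverse, so a computation with `t` steps
bounds the area by `t` (`exists_prod_of_reachesIn`).

Conversely, a word of area `k` and length `n` must be accepted in time linear in `n + k`, although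
the conjugators in a product of `k` conjugates may be arbitrarily long. The remedy is `FillsIn`: `k`
insertions of relators, possibly into one another, make the word freely trivial. This is clear for a
product of conjugates spelled out in full, and it is invariant under free equality
(`FillsIn.of_mk_eq`). The hard part is deleting a pair `x x⁻¹` between whose letters words have been
inserted (`remove_conjugation`).

The insertions can then be ordered from left to right, so one pass suffices. The final word has
length at most `n + L * k`, where `L` bounds the lengths of the symmetrized relators, and the pass
takes at most `n + (L + 1) * k` steps. -/

/-! ### Successive insertions into a word -/

/-- `InsertsTo S w k w'`: the word `w'` is obtained from `w` by `k` successive insertions of words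
of `S`. -/
inductive InsertsTo {α : Type u} (S : Set (List α)) (w : List α) : ℕ → List α → Prop
  | refl : InsertsTo S w 0 w
  | insert {k : ℕ} {c d s : List α} : s ∈ S → InsertsTo S w k (c ++ d) →
      InsertsTo S w (k + 1) (c ++ s ++ d)

namespace InsertsTo

variable {α : Type u} {S : Set (List α)}

theorem append_left {w w' : List α} {k : ℕ} (a : List α) (h : InsertsTo S w k w') :
    InsertsTo S (a ++ w) k (a ++ w') := by
  induction h with
  | refl => exact refl
  | @insert k c d s hs _ ih =>
    have := insert (c := a ++ c) (d := d) hs (by simpa using ih)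
    simpa using this

theorem trans {a b c : List α} {i j : ℕ} (h : InsertsTo S a i b) (h' : InsertsTo S b j c) :
    InsertsTo S a (i + j) c := by
  induction h' with
  | refl => exact h
  | insert hs _ ih => exact insert hs ih

theorem append_right {w w' : List α} {k : ℕ} (b : List α) (h : InsertsTo S w k w') :
    InsertsTo S (w ++ b) k (w' ++ b) := by
  induction h with
  | refl => exact refl
  | @insert k c d s hs _ ih =>
    have := insert (c := c) (d := d ++ b) hs (by simpa using ih)
    simpa using this

theorem append {a a' b b' : List α} {i j : ℕ} (h : InsertsTo S a i a') (h' : InsertsTo S b j b') :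
    InsertsTo S (a ++ b) (i + j) (a' ++ b') :=
  (h.append_right b).trans (h'.append_left a')

/-- A word obtained from the empty word can be inserted anywhere. -/
theorem insert_word {w c d p : List α} {i j : ℕ} (h : InsertsTo S w i (c ++ d))
    (hp : InsertsTo S [] j p) : InsertsTo S w (i + j) (c ++ p ++ d) := by
  refine h.trans ?_
  simpa using (hp.append_left c).append_right d

theorem exists_append {a b w : List α} {k : ℕ} (h : InsertsTo S (a ++ b) k w) :
    ∃ i j a' b', i + j = k ∧ w = a' ++ b' ∧ InsertsTo S a i a' ∧ InsertsTo S b j b' := by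
  induction h with
  | refl => exact ⟨0, 0, a, b, rfl, rfl, refl, refl⟩
  | @insert k c d s hs _ ih =>
    obtain ⟨i, j, a', b', rfl, he, ha, hb⟩ := ih
    rcases List.append_eq_append_iff.1 he with ⟨e, rfl, rfl⟩ | ⟨e, rfl, rfl⟩
    · refine ⟨i + 1, j, c ++ s ++ e, b', by omega, by simp, insert hs ha, hb⟩
    · refine ⟨i, j + 1, a', e ++ s ++ d, by omega, by simp, ha, insert hs hb⟩

theorem exists_singleton {x : α} {w : List α} {k : ℕ} (h : InsertsTo S [x] k w) :
    ∃ i j p q, i + j = k ∧ w = p ++ x :: q ∧ InsertsTo S [] i p ∧ InsertsTo S [] j q := by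
  induction h with
  | refl => exact ⟨0, 0, [], [], rfl, rfl, refl, refl⟩
  | @insert k c d s hs _ ih =>
    obtain ⟨i, j, p, q, rfl, he, hp, hq⟩ := ih
    rcases List.append_eq_append_iff.1 he with ⟨e, rfl, rfl⟩ | ⟨e, rfl, he'⟩
    · exact ⟨i + 1, j, c ++ s ++ e, q, by omega, by simp, insert hs hp, hq⟩
    · rcases List.cons_eq_append_iff.1 he' with ⟨rfl, rfl⟩ | ⟨e, rfl, rfl⟩
      · exact ⟨i + 1, j, p ++ s, q, by omega, by simp,
          by simpa using insert (d := []) hs (by simpa using hp), hq⟩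
      · exact ⟨i, j + 1, p, e ++ s ++ d, by omega, by simp, hp, insert hs hq⟩

/-- If `S` is closed under cyclic rotation, so is the set of words obtained from the empty one. -/
theorem rotate (hS : ∀ a b, a ++ b ∈ S → b ++ a ∈ S) {p q : List α} {k : ℕ}
    (h : InsertsTo S [] k (p ++ q)) : InsertsTo S [] k (q ++ p) := by
  generalize hw : p ++ q = w at h
  induction h generalizing p q with
  | refl =>
    obtain ⟨rfl, rfl⟩ := List.append_eq_nil_iff.1 hw
    exact refl
  | @insert k c d s hs hcd ih =>
    rcases List.append_eq_append_iff.1 hw with ⟨e, he, rfl⟩ | ⟨e, rfl, rfl⟩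
    · rcases List.append_eq_append_iff.1 he with ⟨f, rfl, rfl⟩ | ⟨f, rfl, rfl⟩
      -- The cut falls inside the inserted word `f ++ e`: its rotation `e ++ f` is inserted first,
      -- and `d ++ c`, obtained by induction, goes between `e` and `f`.
      · have h1 : InsertsTo S [] 1 (e ++ f) := by
          simpa using insert (c := []) (d := []) (hS _ _ hs) refl
        have h2 := h1.insert_word (ih rfl)
        rw [add_comm] at h2
        simpa using h2
      · have := ih (p := p) (q := f ++ d) (by simp)
        simpa using insert (c := f) (d := d ++ p) hs (by simpa using this)
    · have := ih (p := c ++ e) (q := q) (by simp)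
      simpa using insert (c := q ++ c) (d := e) hs (by simpa using this)

theorem length_le {L : ℕ} (hL : ∀ s ∈ S, s.length ≤ L) {w w' : List α} {k : ℕ}
    (h : InsertsTo S w k w') : w'.length ≤ w.length + L * k := by
  induction h with
  | refl => simp
  | insert hs _ ih =>
    have := hL _ hs
    simp only [List.length_append] at ih ⊢
    rw [mul_add]
    omega

end InsertsTo

/-! ### Matching letters in freely trivial words -/

namespace FreeGroup

variable {X : Type u}

/-- Undoing a cancellation puts a pair on one side of the surviving letter, and that side stays
trivial. -/
theorem Red.exists_of_singleton {w : List (X × Bool)} {y : X × Bool} (h : Red w [y]) :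
    ∃ a b, w = a ++ y :: b ∧ mk a = 1 ∧ mk b = 1 := by
  induction h using Relation.ReflTransGen.head_induction_on with
  | refl => exact ⟨[], [], rfl, rfl, rfl⟩
  | head hs _ ih =>
    obtain ⟨a, b, he, ha, hb⟩ := ih
    obtain ⟨x, t⟩ := y
    cases hs with
    | @not L₁ L₂ z t' =>
      rcases List.append_eq_append_iff.1 he with ⟨e, rfl, rfl⟩ | ⟨e, rfl, he'⟩
      · refine ⟨L₁ ++ (z, t') :: (z, !t') :: e, b, by simp, ?_, hb⟩
        rw [← ha]
        exact Quot.sound Red.Step.not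
      · rcases List.cons_eq_append_iff.1 he' with ⟨rfl, rfl⟩ | ⟨e, rfl, rfl⟩
        · refine ⟨a ++ [(z, t'), (z, !t')], b, by simp, ?_, hb⟩
          rw [← ha]
          exact Quot.sound (by simpa using Red.Step.not (L₁ := a) (L₂ := []) (x := z) (b := t'))
        · refine ⟨a, e ++ (z, t') :: (z, !t') :: L₂, by simp, ha, ?_⟩
          rw [← hb]
          exact Quot.sound Red.Step.not

/-- In a word representing `1`, every letter is matched with an inverse letter. -/
theorem exists_matching {a b : List (X × Bool)} {x : X} {t : Bool}
    (h : mk (a ++ (x, t) :: b) = 1) :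
    (∃ b₁ b₂, b = b₁ ++ (x, !t) :: b₂ ∧ mk b₁ = 1) ∨
      ∃ a₁ a₂, a = a₁ ++ (x, !t) :: a₂ ∧ mk a₂ = 1 := by
  classical
  by_cases hb : ∃ ρ, (mk b).toWord = (x, !t) :: ρ
  · obtain ⟨ρ, hρ⟩ := hb
    have hr : Red b ([(x, !t)] ++ ρ) := by
      rw [List.singleton_append, ← hρ, toWord_mk]
      exact reduce.red
    obtain ⟨c, d, rfl, hc, -⟩ := Red.to_append_iff.1 hr
    obtain ⟨e, f, rfl, he, -⟩ := hc.exists_of_singleton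
    exact Or.inl ⟨e, f ++ d, by simp, he⟩
  -- Otherwise `x` does not cancel against the normal form of `b`, so the normal form of `a`, being
  -- inverse to that of `x b`, ends with `x⁻¹`.
  · have hred : IsReduced ((x, t) :: (mk b).toWord) := by
      have h0 := isReduced_toWord (x := mk b)
      cases hw : (mk b).toWord with
      | nil => exact IsReduced.singleton
      | cons z ρ =>
        rw [hw] at h0
        rw [isReduced_cons_cons]
        refine ⟨?_, h0⟩
        rintro (rfl : x = z.1)
        by_contra hne
        refine hb ⟨ρ, ?_⟩
        rw [hw]
        congr 1
        ext
        · rfl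
        · cases t <;> simp_all
    have ha : mk a = mk (invRev ((x, t) :: (mk b).toWord)) := by
      rw [← inv_mk, eq_inv_iff_mul_eq_one, ← h, ← mul_mk, ← List.singleton_append,
        ← mul_mk (L₁ := [(x, t)]), mk_toWord, mul_mk (L₁ := [(x, t)])]
      rfl
    have hr : Red a (invRev (mk b).toWord ++ [(x, !t)]) := by
      have : reduce a = invRev (mk b).toWord ++ [(x, !t)] := by
        rw [reduce.sound ha, reduce_invRev, hred.reduce_eq]
        simp [invRev]
      rw [← this]
      exact reduce.red
    obtain ⟨c, d, rfl, -, hd⟩ := Red.to_append_iff.1 hr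
    obtain ⟨e, f, rfl, -, hf⟩ := hd.exists_of_singleton
    exact Or.inr ⟨c ++ e, f, by simp, hf⟩

end FreeGroup

/-! ### Fillings and their invariance under free equality -/

/-- `k` insertions of words of `S` turn `w` into a word that is freely equal to `1`. -/
def FillsIn {X : Type u} (S : Set (List (X × Bool))) (k : ℕ) (w : List (X × Bool)) : Prop :=
  ∃ w', InsertsTo S w k w' ∧ FreeGroup.mk w' = 1

namespace FillsIn

open FreeGroup

variable {X : Type u} {S : Set (List (X × Bool))} {k : ℕ}

theorem append {i j : ℕ} {a b : List (X × Bool)} (ha : FillsIn S i a) (hb : FillsIn S j b) :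
    FillsIn S (i + j) (a ++ b) := by
  obtain ⟨a', ha, ha'⟩ := ha
  obtain ⟨b', hb, hb'⟩ := hb
  exact ⟨a' ++ b', ha.append hb, by rw [← mul_mk, ha', hb', one_mul]⟩

theorem insert_cancelling {a b : List (X × Bool)} {x : X} {t : Bool}
    (h : FillsIn S k (a ++ b)) : FillsIn S k (a ++ (x, t) :: (x, !t) :: b) := by
  obtain ⟨w', h, hw⟩ := h
  obtain ⟨i, j, a', b', rfl, rfl, ha, hb⟩ := h.exists_append
  refine ⟨a' ++ (x, t) :: (x, !t) :: b', ?_, ?_⟩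
  · exact ha.append (by simpa using hb.append_left [(x, t), (x, !t)])
  · rw [← hw]
    exact Quot.sound Red.Step.not

/-- If the letter `x` and the inverse letter around `p` are deleted from a word representing `1`,
then `p`, or a rotation of it, can be inserted somewhere else so that the word represents `1`
again: the place is determined by the letter with which `x` is matched. -/
theorem remove_conjugation (hS : ∀ a b, a ++ b ∈ S → b ++ a ∈ S)
    {a a' b b' p : List (X × Bool)} {x : X} {t : Bool} {i j l : ℕ} (ha : InsertsTo S a i a')
    (hp : InsertsTo S [] j p) (hb : InsertsTo S b l b')
    (hw : mk (a' ++ (x, t) :: (p ++ (x, !t) :: b')) = 1) : FillsIn S (i + l + j) (a ++ b) := by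
  obtain ⟨g, hg, hg'⟩ : ∃ g : FreeGroup X, (∀ u, mk ((x, t) :: u) = g * mk u) ∧
      ∀ u, mk ((x, !t) :: u) = g⁻¹ * mk u :=
    ⟨mk [(x, t)], fun u => by simp, fun u => by simp [invRev]⟩
  have hab := ha.append hb
  -- The partner of `x` may be the deleted `x⁻¹`, and then `p` is trivial and stays in place. If it
  -- lies in `b'` or in `a'`, then `p` is inserted just before it. If it lies in `p`, then a
  -- rotation of `p` stays in place.
  rcases exists_matching hw with ⟨b₁, b₂, he, h1⟩ | ⟨a₁, a₂, rfl, h1⟩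
  · rcases List.append_eq_append_iff.1 he with ⟨e, rfl, he'⟩ | ⟨e, rfl, he'⟩
    · rcases List.cons_eq_append_iff.1 he' with ⟨rfl, he''⟩ | ⟨e, rfl, rfl⟩
      · refine ⟨_, hab.insert_word hp, ?_⟩
        rw [List.append_nil] at h1
        simp only [← mul_mk, hg, hg', h1] at hw ⊢
        simpa using hw
      · refine ⟨_, InsertsTo.insert_word (c := a' ++ e) (d := (x, !t) :: b₂)
          (by simpa using hab) hp, ?_⟩
        simp only [← mul_mk, hg, hg'] at hw h1 ⊢
        have hE : mk e = g * (mk p)⁻¹ := by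
          rw [← inv_mul_eq_iff_eq_mul, eq_inv_iff_mul_eq_one, mul_eq_one_comm, h1]
        simpa [hE, mul_assoc, -mul_mk, -inv_mk] using hw
    · rcases List.cons_eq_append_iff.1 he' with ⟨rfl, he''⟩ | ⟨e, rfl, rfl⟩
      · refine ⟨_, hab.insert_word hp, ?_⟩
        simp only [List.append_nil, ← mul_mk, hg, hg', h1] at hw ⊢
        simpa using hw
      -- Here `p` is `b₁ x⁻¹ e` with `b₁` trivial, so that `x p x⁻¹` equals `e x⁻¹`, as does the
      -- rotation `e b₁ x⁻¹`.
      · have hp' : InsertsTo S [] j (e ++ (b₁ ++ [(x, !t)])) :=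
          InsertsTo.rotate hS (by simpa using hp)
        refine ⟨_, hab.insert_word hp', ?_⟩
        simp only [← mul_mk, hg, hg', h1, ← one_eq_mk] at hw ⊢
        simpa [mul_assoc, -mul_mk] using hw
  · refine ⟨_, InsertsTo.insert_word (c := a₁) (d := (x, !t) :: a₂ ++ b')
      (by simpa using hab) hp, ?_⟩
    simp only [← mul_mk, hg, hg', h1, List.cons_append] at hw ⊢
    simpa [mul_assoc, -mul_mk] using hw

/-- The words inserted just after `x` and just before `x⁻¹` together form the `p` of
`remove_conjugation`; all others belong to the two outer parts. -/
theorem delete_cancelling (hS : ∀ a b, a ++ b ∈ S → b ++ a ∈ S) {a b : List (X × Bool)}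
    {x : X} {t : Bool} (h : FillsIn S k (a ++ (x, t) :: (x, !t) :: b)) :
    FillsIn S k (a ++ b) := by
  obtain ⟨w', h, hw⟩ := h
  obtain ⟨i₁, _, a', _, rfl, rfl, ha, h⟩ := h.exists_append
  obtain ⟨_, _, _, _, rfl, rfl, hx, h⟩ := InsertsTo.exists_append (a := [(x, t)]) h
  obtain ⟨_, i₆, _, b', rfl, rfl, hy, hb⟩ := InsertsTo.exists_append (a := [(x, !t)]) h
  obtain ⟨i₂, i₃, p₁, p₂, rfl, rfl, hp₁, hp₂⟩ := hx.exists_singleton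
  obtain ⟨i₄, i₅, q₁, q₂, rfl, rfl, hq₁, hq₂⟩ := hy.exists_singleton
  replace ha := ha.append hp₁
  replace hb := hq₂.append hb
  have hp := hp₂.append hq₁
  rw [List.append_nil] at ha
  simp only [List.nil_append] at hb hp
  obtain ⟨w', h⟩ := remove_conjugation (x := x) (t := t) hS ha hp hb (by simpa using hw)
  exact ⟨w', by convert h.1 using 1; omega, h.2⟩

/-- By confluence the two words have a common reduct: pairs are deleted on the way down to it and
inserted on the way up. -/
theorem of_mk_eq (hS : ∀ a b, a ++ b ∈ S → b ++ a ∈ S) {w w' : List (X × Bool)}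
    (h : FillsIn S k w) (he : mk w = mk w') : FillsIn S k w' := by
  obtain ⟨z, hz, hz'⟩ := Red.exact.1 he
  have h1 : FillsIn S k z := by
    clear he hz'
    induction hz with
    | refl => exact h
    | tail _ hs ih => cases hs; exact ih.delete_cancelling hS
  clear he hz h
  induction hz' using Relation.ReflTransGen.head_induction_on with
  | refl => exact h1
  | head hs _ ih => cases hs; exact ih.insert_cancelling

end FillsIn

/-! ### Ordering the insertions from left to right -/

/-- `InsertsLeftToRight S k w w'`: the word `w'` is obtained by reading `w` from left to right,
with `k` insertions of words of `S` in front of what remains to be read. -/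
inductive InsertsLeftToRight {α : Type u} (S : Set (List α)) : ℕ → List α → List α → Prop
  | nil : InsertsLeftToRight S 0 [] []
  | cons {k : ℕ} {w w' : List α} (x : α) : InsertsLeftToRight S k w w' →
      InsertsLeftToRight S k (x :: w) (x :: w')
  | insert {k : ℕ} {w w' s : List α} : s ∈ S → InsertsLeftToRight S k (s ++ w) w' →
      InsertsLeftToRight S (k + 1) w w'

namespace InsertsLeftToRight

variable {α : Type u} {S : Set (List α)}

theorem append_left {w w' : List α} {k : ℕ} (h : InsertsLeftToRight S k w w') :
    ∀ a : List α, InsertsLeftToRight S k (a ++ w) (a ++ w')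
  | [] => h
  | x :: a => cons x (h.append_left a)

/-- The new insertion is scheduled for a moment when exactly `c` has been read; `s` is then read
unchanged. -/
theorem insert_middle {w c d s : List α} {k : ℕ} (hs : s ∈ S)
    (h : InsertsLeftToRight S k w (c ++ d)) : InsertsLeftToRight S (k + 1) w (c ++ s ++ d) := by
  generalize hv : c ++ d = v at h
  induction h generalizing c with
  | nil =>
    obtain ⟨rfl, rfl⟩ := List.append_eq_nil_iff.1 hv
    exact insert hs (by simpa using nil.append_left s)
  | cons x h ih =>
    rcases List.append_eq_cons_iff.1 hv with ⟨rfl, rfl⟩ | ⟨c, rfl, rfl⟩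
    · exact insert hs (by simpa using (cons x h).append_left s)
    · exact cons x (ih rfl)
  | insert hs' _ ih => exact insert hs' (ih hv)

theorem _root_.InsertsTo.insertsLeftToRight {w w' : List α} {k : ℕ} (h : InsertsTo S w k w') :
    InsertsLeftToRight S k w w' := by
  induction h with
  | refl => simpa using nil.append_left w
  | insert hs _ ih => exact ih.insert_middle hs

end InsertsLeftToRight

/-! ### Symmetrized relators and products of conjugates -/

namespace FinitePresentation

open FreeGroup

variable {G : Type u} [Group G] {X : Type v} (P : FinitePresentation G X)

/-- The cyclic rotations of the relators and of their inverses, as words. -/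
def symmetrizedRelators : Set (List (X × Bool)) :=
  {s | ∃ a b, s = b ++ a ∧ IsReduced (a ++ b) ∧
    (FreeGroup.mk (a ++ b) ∈ P.rels ∨ (FreeGroup.mk (a ++ b))⁻¹ ∈ P.rels)}

/-- An element of the free group is a conjugate of a relator or of the inverse of a relator. -/
def IsRelatorConjugate (y : FreeGroup X) : Prop :=
  ∃ r ∈ P.rels, ∃ h : FreeGroup X, y = h * r * h⁻¹ ∨ y = h * r⁻¹ * h⁻¹

variable {P} in
theorem IsRelatorConjugate.conj {y : FreeGroup X} (hy : P.IsRelatorConjugate y)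
    (g : FreeGroup X) : P.IsRelatorConjugate (g * y * g⁻¹) := by
  obtain ⟨r, hr, h, rfl | rfl⟩ := hy
  · exact ⟨r, hr, g * h, Or.inl (by group)⟩
  · exact ⟨r, hr, g * h, Or.inr (by group)⟩

variable {P} in
theorem IsRelatorConjugate.inv {y : FreeGroup X} (hy : P.IsRelatorConjugate y) :
    P.IsRelatorConjugate y⁻¹ := by
  obtain ⟨r, hr, h, rfl | rfl⟩ := hy
  · exact ⟨r, hr, h, Or.inr (by group)⟩
  · exact ⟨r, hr, h, Or.inl (by group)⟩

theorem isRelatorConjugate_of_mem {s : List (X × Bool)} (hs : s ∈ P.symmetrizedRelators) :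
    P.IsRelatorConjugate (FreeGroup.mk s) := by
  obtain ⟨a, b, rfl, -, h | h⟩ := hs
  · refine ⟨_, h, (FreeGroup.mk a)⁻¹, Or.inl ?_⟩
    simp only [← mul_mk]
    group
  · refine ⟨_, h, (FreeGroup.mk a)⁻¹, Or.inr ?_⟩
    simp only [← mul_mk]
    group

theorem symmetrizedRelators_rotate (a b : List (X × Bool)) (h : a ++ b ∈ P.symmetrizedRelators) :
    b ++ a ∈ P.symmetrizedRelators := by
  obtain ⟨c, d, he, h⟩ := h
  rcases List.append_eq_append_iff.1 he with ⟨e, rfl, rfl⟩ | ⟨e, rfl, rfl⟩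
  · exact ⟨c ++ a, e, by simp, by simpa using h⟩
  · exact ⟨e, b ++ d, by simp, by simpa using h⟩

theorem finite_symmetrizedRelators : P.symmetrizedRelators.Finite := by
  classical
  have hf : (P.rels ∪ P.rels⁻¹).Finite := P.finite_rels.union P.finite_rels.inv
  refine (hf.biUnion (t := fun r => {s | s ~r r.toWord}) fun r _ => ?_).subset ?_
  · refine (List.finite_toSet r.toWord.cyclicPermutations).subset fun s hs => ?_
    exact List.mem_cyclicPermutations_iff.2 hs
  · rintro s ⟨a, b, rfl, hr, h⟩
    simp only [Set.mem_iUnion]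
    refine ⟨FreeGroup.mk (a ++ b), h, ?_⟩
    rw [Set.mem_ofPred_eq, toWord_mk, hr.reduce_eq]
    exact List.isRotated_append

/-- In the word `g r g⁻¹`, inserting `r⁻¹` after `r` makes everything cancel; invariance under free
equality passes from this word to `w`. -/
theorem fillsIn_of_isRelatorConjugate {w : List (X × Bool)} 
    (h : P.IsRelatorConjugate (FreeGroup.mk w)) :
    FillsIn P.symmetrizedRelators 1 w := by
  classical
  obtain ⟨r, g, hr, h⟩ : ∃ r g, (r ∈ P.rels ∨ r⁻¹ ∈ P.rels) ∧ FreeGroup.mk w = g * r * g⁻¹ := by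
    obtain ⟨r, hr, g, h | h⟩ := h
    · exact ⟨r, g, Or.inl hr, h⟩
    · exact ⟨r⁻¹, g, Or.inr (by simpa using hr), h⟩
  refine FillsIn.of_mk_eq (w := (g.toWord ++ r.toWord) ++ g⁻¹.toWord)
    P.symmetrizedRelators_rotate
    ⟨g.toWord ++ r.toWord ++ r⁻¹.toWord ++ g⁻¹.toWord,
      InsertsTo.insert ⟨[], r⁻¹.toWord, by simp, ?_, ?_⟩ InsertsTo.refl, ?_⟩ ?_
  · exact isReduced_toWord
  · simpa only [List.nil_append, mk_toWord, inv_inv] using hr.symm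
  · simp only [← mul_mk, mk_toWord]
    group
  · simp only [← mul_mk, mk_toWord, h]

theorem fillsIn_of_isProductOfConjugates {w : List (X × Bool)} {k : ℕ}
    (h : P.IsProductOfConjugates w k) : FillsIn P.symmetrizedRelators k w := by
  classical
  obtain ⟨l, rfl, hw, hl⟩ := h
  induction l generalizing w with
  | nil => exact ⟨w, InsertsTo.refl, hw.symm⟩
  | cons y l ih =>
    have h1 : FillsIn P.symmetrizedRelators 1 y.toWord :=
      P.fillsIn_of_isRelatorConjugate (by
        rw [mk_toWord]
        exact hl y List.mem_cons_self)
    have h2 := ih (w := l.prod.toWord) mk_toWord.symm fun z hz => hl z (List.mem_cons_of_mem _ hz)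
    rw [List.length_cons, add_comm]
    refine (h1.append h2).of_mk_eq P.symmetrizedRelators_rotate ?_
    rw [← mul_mk, mk_toWord, mk_toWord, ← hw, List.prod_cons]

end FinitePresentation

/-! ### The one-head machine and its computations -/

/-- The word `left` to the left of the head and the word `right` to the right of it are replaced by
`newLeft` and `newRight`. -/
def HeadCommand.rewrite {Y : Type u} (left right newLeft newRight : List Y) :
    HeadCommand Y Unit := ⟨left, (), right, newLeft, (), newRight⟩

/-- The commands of the machine with one head that moves to the right over a letter, cancels two
inverse letters next to it, or inserts a word of `S` to its right. -/
def fillingCommands {X : Type u} (S : Set (List (X × Bool))) :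
    Set (HeadCommand (X × Bool) Unit) :=
  Set.range (fun x : X × Bool => .rewrite [] [x] [x] []) ∪
  Set.range (fun x : X × Bool => .rewrite [x] [(x.1, !x.2)] [] []) ∪
  (fun s => .rewrite [] [] [] s) '' S

/-- The non-deterministic Turing machine with one head, initially to the left of the input, whose
commands are `fillingCommands S`. It accepts when its tape is empty. -/
def fillingMachine {X : Type u} [Finite X] (S : Set (List (X × Bool))) (hS : S.Finite) :
    TuringMachine (X × Bool) where
  N := 1
  N_pos := one_pos
  Y := X × Bool
  finite_Y := inferInstance
  Q _ := Unit
  finite_Q _ := inferInstance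
  commands := (fun c _ => c) '' fillingCommands S
  finite_commands :=
    (((Set.finite_range _).union (Set.finite_range _)).union (hS.image _)).image _
  inputLetter := .refl _
  inputTape := 1
  startState _ := ()
  acceptConfig := ⟨fun _ => [], fun _ => ()⟩

namespace fillingMachine

open FreeGroup

variable {X : Type u} {S : Set (List (X × Bool))} {hS : S.Finite}

/-- The configuration with `l` to the left and `r` to the right of the head. -/
def config (l r : List (X × Bool)) : TMConfig 1 (X × Bool) fun _ => Unit :=
  ⟨![l, r], fun _ => ()⟩

theorem config_eta (c : TMConfig 1 (X × Bool) fun _ => Unit) :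
    config (c.tape 0) (c.tape 1) = c := by
  obtain ⟨tape, state⟩ := c
  simp only [config, TMConfig.mk.injEq, and_true]
  funext j
  fin_cases j <;> rfl

variable [Finite X]

theorem inputConfig_eq (w : List (X × Bool)) :
    (fillingMachine S hS).inputConfig w = config [] w := by
  refine (config_eta ((fillingMachine S hS).inputConfig w)).symm.trans ?_
  exact congrArg₂ config rfl (List.map_id w)

theorem acceptConfig_eq : (fillingMachine S hS).acceptConfig = config [] [] :=
  (config_eta _).symm

theorem step_iff {l r l' r' : List (X × Bool)} :
    (fillingMachine S hS).Step (config l r) (config l' r') ↔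
      ∃ θ ∈ fillingCommands S, ∃ x y, l = x ++ θ.left ∧ r = θ.right ++ y ∧
        l' = x ++ θ.newLeft ∧ r' = θ.newRight ++ y := by
  constructor
  · rintro ⟨_, ⟨θ, hθ, rfl⟩, x, -, -, h, h'⟩
    exact ⟨θ, hθ, x 0, x 1, h 0, (h 1).trans (List.append_nil _), h' 0,
      (h' 1).trans (List.append_nil _)⟩
  · rintro ⟨θ, hθ, x, y, rfl, rfl, rfl, rfl⟩
    exact ⟨_, ⟨θ, hθ, rfl⟩, ![x, y], fun _ => rfl, fun _ => rfl,
      Fin.forall_fin_two.2 ⟨rfl, (List.append_nil (θ.right ++ y)).symm⟩,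
      Fin.forall_fin_two.2 ⟨rfl, (List.append_nil (θ.newRight ++ y)).symm⟩⟩

theorem step_move (l r : List (X × Bool)) (x : X × Bool) :
    (fillingMachine S hS).Step (config l (x :: r)) (config (l ++ [x]) r) :=
  step_iff.2 ⟨_, Or.inl (Or.inl ⟨x, rfl⟩), l, r, by simp [HeadCommand.rewrite]⟩

theorem step_cancel (l r : List (X × Bool)) (x : X × Bool) :
    (fillingMachine S hS).Step (config (l ++ [x]) ((x.1, !x.2) :: r)) (config l r) :=
  step_iff.2 ⟨_, Or.inl (Or.inr ⟨x, rfl⟩), l, r, by simp [HeadCommand.rewrite]⟩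

theorem step_insert (l r : List (X × Bool)) {s : List (X × Bool)} (hs : s ∈ S) :
    (fillingMachine S hS).Step (config l r) (config l (s ++ r)) :=
  step_iff.2 ⟨_, Or.inr ⟨s, hs, rfl⟩, l, r, by simp [HeadCommand.rewrite]⟩

theorem mk_eq_or_of_step {l r l' r' : List (X × Bool)}
    (h : (fillingMachine S hS).Step (config l r) (config l' r')) :
    FreeGroup.mk (l ++ r) = FreeGroup.mk (l' ++ r') ∨
      ∃ s ∈ S, l' = l ∧ r' = s ++ r := by
  obtain ⟨_, (⟨x, rfl⟩ | ⟨x, rfl⟩) | ⟨s, hs, rfl⟩, a, b, rfl, rfl, rfl, rfl⟩ := step_iff.1 h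
  · exact Or.inl (by simp [HeadCommand.rewrite])
  · refine Or.inl ?_
    have : FreeGroup.mk (a ++ (x.1, x.2) :: (x.1, !x.2) :: r') = FreeGroup.mk (a ++ r') :=
      Quot.sound Red.Step.not
    simpa [HeadCommand.rewrite] using this
  · exact Or.inr ⟨s, hs, by simp [HeadCommand.rewrite]⟩

/-- A computation with `t` steps writes its input as a product of at most `t` conjugates of words
of `S`. -/
theorem exists_prod_of_reachesIn {C : FreeGroup X → Prop} (hC : ∀ s ∈ S, C (FreeGroup.mk s))
    (hconj : ∀ y g, C y → C (g * y * g⁻¹)) (hinv : ∀ y, C y → C y⁻¹) {t : ℕ}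
    {l r : List (X × Bool)}
    (h : (fillingMachine S hS).ReachesIn t (config l r) (config [] [])) :
    ∃ L : List (FreeGroup X), L.length ≤ t ∧ L.prod = FreeGroup.mk (l ++ r) ∧ ∀ y ∈ L, C y := by
  induction t generalizing l r with
  | zero =>
    have h0 := congrArg (fun c => c.tape 0) (show config l r = config [] [] from h)
    have h1 := congrArg (fun c => c.tape 1) (show config l r = config [] [] from h)
    obtain rfl : l = [] := h0
    obtain rfl : r = [] := h1
    exact ⟨[], le_rfl, rfl, by simp⟩
  | succ t ih =>
    obtain ⟨e, hs, h⟩ := h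
    rw [← config_eta e] at hs h
    obtain ⟨L, hL, hp, hy⟩ := ih h
    rcases mk_eq_or_of_step hs with he | ⟨s, hs, h0, h1⟩
    · exact ⟨L, by omega, hp.trans he.symm, hy⟩
    -- In the free group `l r = (l s⁻¹ l⁻¹) (l s r)`.
    · refine ⟨(FreeGroup.mk l * (FreeGroup.mk s)⁻¹ * (FreeGroup.mk l)⁻¹) :: L,
        by simpa using hL, ?_, ?_⟩
      · rw [List.prod_cons, hp, h0, h1]
        simp only [← mul_mk]
        group
      · rintro y hy'
        rcases List.mem_cons.1 hy' with rfl | hy'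
        · exact hconj _ _ (hinv _ (hC s hs))
        · exact hy y hy'

/-- The head cancels whenever it can, which keeps the word on its left reduced; at the end that word
is trivial, hence empty. Each insertion and each letter of `r'` costs one step. -/
theorem reachesIn_of_insertsLeftToRight {k : ℕ} {l r r' : List (X × Bool)}
    (h : InsertsLeftToRight S k r r') (hl : IsReduced l) (h1 : FreeGroup.mk (l ++ r') = 1) :
    (fillingMachine S hS).ReachesIn (k + r'.length) (config l r) (config [] []) := by
  classical
  induction h generalizing l with
  | nil =>
    rw [List.append_nil] at h1
    have : l = [] := by rw [← hl.reduce_eq, ← toWord_mk, h1, toWord_one]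
    rw [this]
    rfl
  | @cons k w w' x h ih =>
    by_cases hx : ∃ l', l = l' ++ [(x.1, !x.2)]
    · obtain ⟨l, rfl⟩ := hx
      refine ⟨config l w, by simpa using step_cancel l w (x.1, !x.2), ih ?_ ?_⟩
      · exact hl.infix (List.prefix_append _ _).isInfix
      · rw [← h1]
        have : FreeGroup.mk (l ++ (x.1, !x.2) :: (x.1, x.2) :: w') = FreeGroup.mk (l ++ w') :=
          Quot.sound Red.Step.not_rev
        simpa using this.symm
    · refine ⟨config (l ++ [x]) w, step_move l w x, ih ?_ (by simpa using h1)⟩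
      refine List.isChain_append.2 ⟨hl, List.isChain_singleton _, ?_⟩
      intro y hy z hz h12
      obtain rfl : x = z := by simpa using hz
      obtain ⟨l', rfl⟩ := List.getLast?_eq_some_iff.1 hy
      by_contra hne
      refine hx ⟨l', ?_⟩
      congr 2
      ext
      · exact h12
      · revert hne
        cases y.2 <;> cases x.2 <;> simp
  | @insert k w w' s hs _ ih =>
    rw [Nat.add_right_comm]
    exact ⟨config l (s ++ w), step_insert l w hs, ih hl h1⟩

theorem acceptsIn_of_fillsIn {L : ℕ} (hL : ∀ s ∈ S, s.length ≤ L) {k : ℕ} {w : List (X × Bool)}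
    (h : FillsIn S k w) :
    ∃ t ≤ w.length + (L + 1) * k, (fillingMachine S hS).AcceptsIn w t := by
  obtain ⟨w', h, hw⟩ := h
  refine ⟨k + w'.length, ?_, ?_⟩
  · have := h.length_le hL
    rw [add_mul]
    omega
  · rw [TuringMachine.AcceptsIn, inputConfig_eq, acceptConfig_eq]
    exact reachesIn_of_insertsLeftToRight h.insertsLeftToRight IsReduced.nil hw

end fillingMachine

/-! ### Comparison of the time function with the Dehn function -/

namespace FinitePresentation

variable {G : Type u} [Group G] {X : Type v} (P : FinitePresentation G X)

theorem eval_eq_one_of_isProductOfConjugates {w : List (X × Bool)} {k : ℕ}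
    (h : P.IsProductOfConjugates w k) : P.eval w = 1 := by
  obtain ⟨l, -, hw, hl⟩ := h
  have : l.prod ∈ (FreeGroup.lift P.gen).ker := by
    refine Subgroup.list_prod_mem _ fun y hy => ?_
    rw [P.ker_eq]
    obtain ⟨r, hr, g, rfl | rfl⟩ := hl y hy
    · exact Subgroup.normalClosure_normal.conj_mem _ (Subgroup.subset_normalClosure hr) g
    · exact Subgroup.normalClosure_normal.conj_mem _
        (inv_mem (Subgroup.subset_normalClosure hr)) g
  rw [hw] at this
  exact this

theorem dehnFunction_mono : Monotone P.dehnFunction := fun _ n h =>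
  (P.dehnFunction_isLeast _).2 fun w hw h1 => (P.dehnFunction_isLeast n).1 w (hw.trans h) h1

end FinitePresentation

theorem mainTheorem11 {G : Type u} [Group G] {X : Type v} (P : FinitePresentation G X) :
    ∃ M : TuringMachine (X × Bool),
      TuringMachine.SolvesWordProblem P M ∧
      GrowthEquivalent P.dehnFunction M.timeFunction := by
  have := P.finite_gens
  set S := P.symmetrizedRelators
  have hfin : S.Finite := P.finite_symmetrizedRelators
  set M := fillingMachine S hfin with hM
  obtain ⟨L, hL⟩ : ∃ L, ∀ s ∈ S, s.length ≤ L := by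
    obtain ⟨L, hL⟩ := (hfin.image List.length).bddAbove
    exact ⟨L, fun s hs => hL ⟨s, hs, rfl⟩⟩
  have hsound : ∀ w t, M.AcceptsIn w t → ∃ k ≤ t, P.IsProductOfConjugates w k := by
    intro w t h
    rw [TuringMachine.AcceptsIn, fillingMachine.inputConfig_eq,
      fillingMachine.acceptConfig_eq] at h
    obtain ⟨l, hl, hp, hy⟩ := fillingMachine.exists_prod_of_reachesIn
      (C := P.IsRelatorConjugate) (fun s hs => P.isRelatorConjugate_of_mem hs)
      (fun _ g h => h.conj g) (fun _ h => h.inv) h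
    exact ⟨l.length, hl, l, rfl, hp, hy⟩
  have hcomplete : ∀ w, P.eval w = 1 → ∃ t ≤ w.length + (L + 1) * P.area w, M.AcceptsIn w t :=
    fun w hw => fillingMachine.acceptsIn_of_fillsIn hL
      (P.fillsIn_of_isProductOfConjugates (P.area_isLeast hw).1)
  have hsolves : TuringMachine.SolvesWordProblem P M := by
    refine fun w => ⟨?_, fun hw => ?_⟩
    · rintro ⟨t, ht⟩
      obtain ⟨k, -, hk⟩ := hsound w t ht
      exact P.eval_eq_one_of_isProductOfConjugates hk
    · obtain ⟨t, -, ht⟩ := hcomplete w hw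
      exact ⟨t, ht⟩
  have hlower : ∀ n, P.dehnFunction n ≤ M.timeFunction n := by
    refine fun n => (P.dehnFunction_isLeast n).2 fun w hn hw => ?_
    obtain ⟨s, hs, h⟩ := (M.timeFunction_isLeast n).1 w hn ((hsolves w).2 hw)
    obtain ⟨k, hk, h⟩ := hsound w s h
    exact ((P.area_isLeast hw).2 h).trans (hk.trans hs)
  have hmono : Monotone M.timeFunction := fun m n h =>
    (M.timeFunction_isLeast m).2 fun w hw => (M.timeFunction_isLeast n).1 w (hw.trans h)
  have hupper : ∀ n, M.timeFunction n ≤ n + (L + 1) * P.dehnFunction n := by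
    refine fun n => (M.timeFunction_isLeast n).2 fun w hn hw => ?_
    have hw := (hsolves w).1 hw
    obtain ⟨t, ht, h⟩ := hcomplete w hw
    refine ⟨t, ht.trans ?_, h⟩
    gcongr
    exact (P.dehnFunction_isLeast n).1 w hn hw
  refine ⟨M, hsolves, L + 1, L.succ_pos, fun n => ⟨?_, ?_⟩⟩
  · have h : M.timeFunction (n / (L + 1)) ≤ n + (L + 1) * P.dehnFunction n :=
      (hupper _).trans (add_le_add (Nat.div_le_self _ _)
        (Nat.mul_le_mul_left _ (P.dehnFunction_mono (Nat.div_le_self _ _))))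
    have h' : (M.timeFunction (n / (L + 1)) : ℝ) ≤ n + (L + 1) * P.dehnFunction n := by
      exact_mod_cast h
    have hL0 : (0 : ℝ) < L + 1 := by positivity
    push_cast
    rw [sub_le_iff_le_add, one_div, inv_mul_le_iff₀ hL0]
    refine h'.trans ?_
    -- With `C = L + 1`, this is `(C ^ 2 - 1) * n`, the slack between `n` and the permitted `C * (C
    -- * n)`.
    have : (0 : ℝ) ≤ n * (L * (L + 2)) := by positivity
    nlinarith
  · have h : P.dehnFunction n ≤
        (L + 1) * M.timeFunction ((L + 1) * n) + (L + 1) * n := by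
      have h1 : M.timeFunction n ≤ M.timeFunction ((L + 1) * n) := hmono (by nlinarith)
      have h2 := hlower n
      nlinarith
    exact_mod_cast h
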